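/- Let $q_1,q_2,q_3\in(0,1)$, let $G\in GL(3,\mathbb R)$, and define $$A=\frac1{q_3}\Big[\Big(1-\prod_{i=1}^3(1-q_i)\Big)\,G^{-1}\,\mathrm{diag}\Big(0,\ \frac1{1-q_1},\ \frac{q_2}{q_1+q_2-q_1q_2}\Big)\,G-q_2(1-q_3)I\Big]\in\mathbb R^{3\times3}.$$ Let $M\in\mathbb R^{3\times3}$, $N\in GL(3,\mathbb R)$ and $K=\{M,\ N+M,\ NA+M\}$. Then for every non-empty bounded open set $\Omega\subset\mathbb R^3$ the set $K$ is non-rigid for approximate solutions on $\Omega$; that is, there is a sequence $(B_h)_{h\in\mathbb N}$ in $L^\infty(\Omega,\mathbb R^{3\times3})$ with $\sup_h\|B_h\|_{L^\infty}<\infty$ such that 1. $\mathrm{Div}\,B_h\to0$ in $W^{-1,\infty}(\Omega,\mathbb R^3)$, where $\mathrm{Div}$ is the row-wise distributional divergence and $W^{-1,\infty}(\Omega)$ is the dual of $W^{1,1}_0(\Omega)$; 2. $\mathrm{dist}(B_h,K)\to0$ in measure on $\Omega$; 3. for every $A'\in K$, $\mathrm{dist}(B_h,A')\not\to0$ in measure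 on $\Omega$, and this also holds for every subsequence of $(B_h)$. -/

import Mathlib

open MeasureTheory Filter Topology TopologicalSpace
open scoped ENNReal NNReal Distributions

noncomputable section

-- Matrices carry the Frobenius (Euclidean) norm; on a finite-dimensional space the choice of the
-- norm does not affect any of the notions below.
open scoped Matrix.Norms.Frobenius

namespace DivFree

/-- `Ω ⊂ ℝⁿ` is an open set; this is Lebesgue measure restricted to it. -/
abbrev vol {n : ℕ} (Ω : Opens (EuclideanSpace ℝ (Fin n))) :
    Measure (EuclideanSpace ℝ (Fin n)) :=
  volume.restrict (Ω : Set (EuclideanSpace ℝ (Fin n)))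

/-- The distributional row-wise divergence: the `i`-th component of `Div B` is the divergence of
the `i`-th row of `B`, acting on a test function `φ ∈ C_c^∞(Ω)` by
`⟨(Div B)_i, φ⟩ = - ∫_Ω ∑_j B_{ij} ∂_j φ`. -/
def distribDiv {m n : ℕ} (Ω : Opens (EuclideanSpace ℝ (Fin n)))
    (B : EuclideanSpace ℝ (Fin n) → Matrix (Fin m) (Fin n) ℝ) (i : Fin m)
    (φ : 𝓓(Ω, ℝ)) : ℝ :=
  -∫ x, ∑ j : Fin n, B x i j * fderiv ℝ φ x (EuclideanSpace.single j 1) ∂(vol Ω)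

/-- The `W^{1,1}` norm of a test function. -/
def sobolevNormOneOne {n : ℕ} (Ω : Opens (EuclideanSpace ℝ (Fin n))) (φ : 𝓓(Ω, ℝ)) : ℝ :=
  (∫ x, ‖φ x‖ ∂(vol Ω)) + ∫ x, ‖fderiv ℝ φ x‖ ∂(vol Ω)

/-- The norm of `W^{-1,∞}(Ω) = (W_0^{1,1}(Ω))'` of a functional on test functions (`∞` if the
functional does not extend to a bounded functional on `W_0^{1,1}(Ω)`, the closure of the test
functions in the `W^{1,1}` norm). -/
def negSobolevNorm {n : ℕ} (Ω : Opens (EuclideanSpace ℝ (Fin n))) (T : 𝓓(Ω, ℝ) → ℝ) : ℝ≥0∞ :=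
  ⨆ (φ : 𝓓(Ω, ℝ)) (_ : sobolevNormOneOne Ω φ ≤ 1), ENNReal.ofReal |T φ|

/-- `B_h` is an approximate solution for the set `K` of `m × n` matrices on `Ω`. The last condition
says that no subsequence of `B_h` converges in measure to an element of `K`; the subsequence
`σ = id` gives that `dist(B_h, A)` does not tend to `0` in measure for any `A ∈ K`. -/
structure IsApproximateSolution {m n : ℕ} (Ω : Opens (EuclideanSpace ℝ (Fin n)))
    (K : Set (Matrix (Fin m) (Fin n) ℝ))
    (B : ℕ → EuclideanSpace ℝ (Fin n) → Matrix (Fin m) (Fin n) ℝ) : Prop where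
  /-- `B_h` is a sequence in `L^∞(Ω, 𝕄^{m×n})`, bounded uniformly in `h`. -/
  bounded : ∃ C : ℝ≥0, ∀ h, MemLp (B h) ∞ (vol Ω) ∧ eLpNorm (B h) ∞ (vol Ω) ≤ C
  /-- `Div B_h → 0` in `W^{-1,∞}(Ω, ℝ^m)`. -/
  div_tendsto : ∀ i : Fin m,
    Tendsto (fun h => negSobolevNorm Ω (distribDiv Ω (B h) i)) atTop (𝓝 0)
  /-- `dist(B_h, K) → 0` in measure. -/
  dist_tendsto : TendstoInMeasure (vol Ω) (fun h x => Metric.infDist (B h x) K) atTop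
    (fun _ => (0 : ℝ))
  /-- For every `A ∈ K`, `dist(B_h, A)` does not tend to `0` in measure, along any subsequence. -/
  not_tendsto : ∀ A ∈ K, ∀ σ : ℕ → ℕ, StrictMono σ →
    ¬ TendstoInMeasure (vol Ω) (fun h x => dist (B (σ h) x) A) atTop (fun _ => (0 : ℝ))

/-- `K` is rigid for approximate solutions on `Ω`: there is no approximate solution. -/
def IsRigidForApproximateSolutions {m n : ℕ} (Ω : Opens (EuclideanSpace ℝ (Fin n)))
    (K : Set (Matrix (Fin m) (Fin n) ℝ)) : Prop :=
  ¬ ∃ B : ℕ → EuclideanSpace ℝ (Fin n) → Matrix (Fin m) (Fin n) ℝ, IsApproximateSolution Ω K B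

/-- The matrix
`A = (1/q₃) [(1 - ∏ (1 - qᵢ)) G⁻¹ diag(0, 1/(1-q₁), q₂/(q₁+q₂-q₁q₂)) G - q₂ (1-q₃) I]`. -/
def matrixA (q₁ q₂ q₃ : ℝ) (G : Matrix.GeneralLinearGroup (Fin 3) ℝ) :
    Matrix (Fin 3) (Fin 3) ℝ :=
  (1 / q₃) •
    ((1 - (1 - q₁) * (1 - q₂) * (1 - q₃)) •
        (((G⁻¹ : Matrix.GeneralLinearGroup (Fin 3) ℝ) : Matrix (Fin 3) (Fin 3) ℝ) *
          Matrix.diagonal ![0, 1 / (1 - q₁), q₂ / (q₁ + q₂ - q₁ * q₂)] *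
          (G : Matrix (Fin 3) (Fin 3) ℝ)) -
      (q₂ * (1 - q₃)) • (1 : Matrix (Fin 3) (Fin 3) ℝ))

end DivFree

end

open MeasureTheory Filter Topology TopologicalSpace
open scoped ENNReal NNReal Distributions Matrix.Norms.Frobenius

namespace DivFree

/-! For the divergence, two matrices are compatible when their difference kills some `ξ ≠ 0`:
layering them in direction `ξ` creates no divergence. The three points of `K` form a T₃
configuration in this sense. Let `D = G⁻¹ diag(...) G`, and take `M = 0`, `N = I`. Then `D` splits
into `A` and `c₁`, `c₁` into `I` and `c₂`, and `c₂` into `0` and `D` again. The formula for `A` is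
what closes this cycle, and the three diagonal entries make each splitting compatible along a column
of `G⁻¹`.

Running around the cycle forever, each step replaces the region still at a centre by a fine mixture
of a point of `K` and the next centre. The fraction left at centres is a product of numbers at most
`max θ < 1`, so it tends to zero. The resulting bounded fields are almost divergence free and almost
in `K`, yet weakly close to `D ∉ K`. Convergence in measure to a point of `K` would make that point
the weak limit, a contradiction.

The layers are smooth: `B + v (ω - θ) (C (k + 1) - A k)`, where `v` marks the current centre and `ω`
oscillates fast along `ξ` (`IsLaminate.refine`). As `ω` is constant along the rows of `C (k + 1) - A
k`, integration by parts only differentiates `v`, and `∂v (ω - θ)` is small in `W^{-1,∞}` at high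
frequency (`exists_oscillation`). All errors are measured against test functions supported in one
compact set containing `Ω`, so no cut-off or covering of `Ω` is needed. -/

/-! ### Periodic profiles -/

/-- A primitive of a periodic function minus its mean is bounded. -/
theorem abs_integral_sub_mean_le_one {g : ℝ → ℝ} (hg : Continuous g)
    (hper : Function.Periodic g 1) (h0 : ∀ t, 0 ≤ g t) (h1 : ∀ t, g t ≤ 1) (t : ℝ) :
    |∫ s in (0 : ℝ)..t, (g s - ∫ r in (0 : ℝ)..1, g r)| ≤ 1 := by
  set m := ∫ r in (0 : ℝ)..1, g r with hm
  have hm0 : 0 ≤ m := intervalIntegral.integral_nonneg zero_le_one fun s _ => h0 s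
  have hm1 : m ≤ 1 := by
    have := intervalIntegral.integral_mono_on (μ := volume) zero_le_one
      (hg.intervalIntegrable 0 1) (continuous_const (y := (1 : ℝ)) |>.intervalIntegrable 0 1)
      (fun s _ => h1 s)
    simpa using this
  have hc : Continuous fun s => g s - m := by fun_prop
  have hp : Function.Periodic (fun s => g s - m) 1 := fun s => by simp [hper s]
  have hz : ∫ s in (0 : ℝ)..1, (g s - m) = 0 := by
    rw [intervalIntegral.integral_sub (hg.intervalIntegrable 0 1)
      (continuous_const.intervalIntegrable 0 1)]
    simp [hm]
  -- Whole periods contribute nothing; what remains is an interval of length below `1` with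
  -- integrand bounded by `1`.
  have h2 := hp.intervalIntegral_add_zsmul_eq ⌊t⌋ 0 (fun a b => hc.intervalIntegrable a b)
  simp only [zero_add, hz, smul_zero, zsmul_eq_mul, mul_one] at h2
  rw [← intervalIntegral.integral_add_adjacent_intervals (hc.intervalIntegrable 0 ⌊t⌋)
    (hc.intervalIntegrable ⌊t⌋ t), h2, zero_add, ← Real.norm_eq_abs]
  refine (intervalIntegral.norm_integral_le_of_norm_le_const (C := 1) fun s _ => ?_).trans ?_
  · rw [Real.norm_eq_abs, abs_le]
    constructor <;> linarith [h0 s, h1 s]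
  · rw [one_mul, abs_of_nonneg (by linarith [Int.floor_le t])]
    linarith [Int.lt_floor_add_one t]

/-- A smooth `1`-periodic profile, which as `k → ∞` approximates the `1`-periodic function that is
`1` on `(-θ/2, θ/2)` and `0` elsewhere in the period. -/
noncomputable def profile (θ : ℝ) (k : ℕ) (t : ℝ) : ℝ :=
  Real.smoothTransition (k * (Real.cos (2 * Real.pi * t) - Real.cos (Real.pi * θ)))

theorem profile_contDiff (θ : ℝ) (k : ℕ) : ContDiff ℝ (⊤ : ℕ∞) (profile θ k) := by
  unfold profile
  refine Real.smoothTransition.contDiff.comp ?_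
  exact contDiff_const.mul ((Real.contDiff_cos.comp (contDiff_const.mul contDiff_id)).sub
    contDiff_const)

theorem profile_nonneg (θ : ℝ) (k : ℕ) (t : ℝ) : 0 ≤ profile θ k t :=
  Real.smoothTransition.nonneg _

theorem profile_le_one (θ : ℝ) (k : ℕ) (t : ℝ) : profile θ k t ≤ 1 :=
  Real.smoothTransition.le_one _

theorem profile_periodic (θ : ℝ) (k : ℕ) : Function.Periodic (profile θ k) 1 := fun t => by
  simp only [profile, mul_add, mul_one, Real.cos_add_two_pi]

/-- On this period `cos (2πt) > cos (πθ)` exactly when `|t| < θ / 2`, so the argument of the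
transition either grows past `1` or stays nonpositive. The values are eventually constant in `k`,
endpoints included. -/
theorem tendsto_profile {θ : ℝ} (hθ : θ ∈ Set.Ioo (0 : ℝ) 1) {t : ℝ}
    (ht : t ∈ Set.Ioc (-(1 / 2) : ℝ) (1 / 2)) :
    Tendsto (fun k => profile θ k t) atTop
      (𝓝 ((Set.Ioo (-(θ / 2)) (θ / 2)).indicator (fun _ => (1 : ℝ)) t)) := by
  have hpi := Real.pi_pos
  have habs : |t| ≤ 1 / 2 := abs_le.2 ⟨ht.1.le, ht.2⟩
  have hcos : Real.cos (2 * Real.pi * t) = Real.cos (2 * Real.pi * |t|) := by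
    rw [← Real.cos_abs (2 * Real.pi * t), abs_mul, abs_of_pos (by positivity : 0 < 2 * Real.pi)]
  by_cases h : t ∈ Set.Ioo (-(θ / 2)) (θ / 2)
  · rw [Set.indicator_of_mem h]
    have hlt : |t| < θ / 2 := abs_lt.2 h
    have hc : 0 < Real.cos (2 * Real.pi * t) - Real.cos (Real.pi * θ) := by
      rw [hcos, sub_pos]
      refine Real.cos_lt_cos_of_nonneg_of_le_pi (by positivity) ?_ ?_
      · nlinarith [hθ.2]
      · nlinarith
    obtain ⟨N, hN⟩ := exists_nat_ge (1 / (Real.cos (2 * Real.pi * t) - Real.cos (Real.pi * θ)))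
    refine tendsto_const_nhds.congr' ?_
    filter_upwards [eventually_ge_atTop N] with k hk
    refine (Real.smoothTransition.one_of_one_le ?_).symm
    rw [← div_le_iff₀ hc]
    exact hN.trans (by exact_mod_cast hk)
  · rw [Set.indicator_of_notMem h]
    have hge : θ / 2 ≤ |t| := by
      by_contra hlt
      exact h (abs_lt.1 (not_le.1 hlt))
    refine tendsto_const_nhds.congr fun k => ?_
    refine (Real.smoothTransition.zero_of_nonpos ?_).symm
    refine mul_nonpos_of_nonneg_of_nonpos (by positivity) ?_
    rw [hcos, sub_nonpos]
    refine Real.cos_le_cos_of_nonneg_of_le_pi (by nlinarith [hθ.1]) ?_ ?_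
    · nlinarith
    · nlinarith

/-- Means over a period of continuous expressions in the profile converge. -/
theorem tendsto_integral_comp_profile {θ : ℝ} (hθ : θ ∈ Set.Ioo (0 : ℝ) 1) {f : ℝ → ℝ}
    (hf : Continuous f) (hf1 : ∀ s ∈ Set.Icc (0 : ℝ) 1, |f s| ≤ 1) (hf0 : f 0 = 0) :
    Tendsto (fun k => ∫ t in (0 : ℝ)..1, f (profile θ k t)) atTop (𝓝 (f 1 * θ)) := by
  have hcont : ∀ k, Continuous fun t => f (profile θ k t) :=
    fun k => hf.comp (profile_contDiff θ k).continuous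
  have hper : ∀ k, Function.Periodic (fun t => f (profile θ k t)) 1 :=
    fun k t => by simp only [profile_periodic θ k t]
  have hshift : ∀ k, ∫ t in (0 : ℝ)..1, f (profile θ k t)
      = ∫ t in (-(1 / 2) : ℝ)..(1 / 2), f (profile θ k t) := fun k => by
    have := (hper k).intervalIntegral_add_eq 0 (-(1 / 2))
    norm_num at this
    norm_num
    exact this
  have hlim : ∫ t in (-(1 / 2) : ℝ)..(1 / 2),
      f ((Set.Ioo (-(θ / 2)) (θ / 2)).indicator (fun _ => (1 : ℝ)) t) = f 1 * θ := by
    have : ∀ t, f ((Set.Ioo (-(θ / 2)) (θ / 2)).indicator (fun _ => (1 : ℝ)) t)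
        = (Set.Ioo (-(θ / 2)) (θ / 2)).indicator (fun _ => f 1) t := fun t => by
      by_cases h : t ∈ Set.Ioo (-(θ / 2)) (θ / 2) <;> simp [h, hf0]
    simp_rw [this]
    rw [intervalIntegral.integral_of_le (by norm_num), integral_indicator measurableSet_Ioo,
      Measure.restrict_restrict measurableSet_Ioo, Set.inter_eq_left.2]
    · simp only [integral_const, MeasurableSet.univ, measureReal_restrict_apply, Set.univ_inter,
        Real.volume_real_Ioo, smul_eq_mul]
      rw [max_eq_left (by linarith [hθ.1])]
      ring
    · intro t ht
      exact ⟨by linarith [ht.1, hθ.2], by linarith [ht.2, hθ.2]⟩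
  simp_rw [hshift]
  rw [← hlim]
  refine intervalIntegral.tendsto_integral_filter_of_dominated_convergence (fun _ => 1) ?_ ?_ ?_ ?_
  · exact Eventually.of_forall fun k => (hcont k).aestronglyMeasurable
  · exact Eventually.of_forall fun k => Eventually.of_forall fun t _ => by
      rw [Real.norm_eq_abs]
      exact hf1 _ ⟨profile_nonneg θ k t, profile_le_one θ k t⟩
  · exact continuous_const.intervalIntegrable _ _
  · refine Eventually.of_forall fun t ht => ?_
    rw [Set.uIoc_of_le (by norm_num)] at ht
    exact (hf.tendsto _).comp (tendsto_profile hθ ht)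

/-! ### Rapidly oscillating functions against functions with compact support -/

section Oscillation

variable {E : Type*} [NormedAddCommGroup E] [InnerProductSpace ℝ E]

/-- `φ` is continuously differentiable with support in `L`. -/
def IsTest (L : Set E) (φ : E → ℝ) : Prop :=
  ContDiff ℝ 1 φ ∧ tsupport φ ⊆ L

theorem IsTest.hasCompactSupport {L : Set E} (hL : IsCompact L) {φ : E → ℝ} (h : IsTest L φ) :
    HasCompactSupport φ :=
  hL.of_isClosed_subset (isClosed_tsupport φ) h.2

theorem IsTest.eq_zero {L : Set E} {φ : E → ℝ} (h : IsTest L φ) {x : E} (hx : x ∉ L) : φ x = 0 :=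
  image_eq_zero_of_notMem_tsupport fun h' => hx (h.2 h')

theorem IsTest.fderiv_eq_zero {L : Set E} {φ : E → ℝ} (h : IsTest L φ) {x : E} (hx : x ∉ L) :
    fderiv ℝ φ x = 0 := by
  by_contra h'
  exact hx (h.2 (support_fderiv_subset ℝ h'))

theorem IsTest.continuous_fderiv {L : Set E} {φ : E → ℝ} (h : IsTest L φ) :
    Continuous (fderiv ℝ φ) :=
  h.1.continuous_fderiv one_ne_zero

/-- Stability under `C¹` multipliers lets fixed coefficients, such as derivatives of `v`, be
absorbed into the test function. -/
theorem IsTest.mul_left {L : Set E} {φ : E → ℝ} (h : IsTest L φ) {u : E → ℝ}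
    (hu : ContDiff ℝ 1 u) : IsTest L fun x => u x * φ x :=
  ⟨hu.mul h.1, (tsupport_mul_subset_right).trans h.2⟩

/-- The derivative of a function of `⟪ξ, x⟫`. -/
theorem hasFDerivAt_comp_inner {w : ℝ → ℝ} {w' : ℝ} (ξ : E) (c : ℝ) (x : E)
    (hw : HasDerivAt w w' (c * inner ℝ ξ x)) :
    HasFDerivAt (fun y => w (c * inner ℝ ξ y)) (w' • c • innerSL ℝ ξ) x := by
  have h : HasFDerivAt (fun y : E => c * inner ℝ ξ y) (c • innerSL ℝ ξ) x :=
    ((innerSL ℝ ξ).hasFDerivAt (x := x)).const_mul c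
  exact hw.comp_hasFDerivAt x h

variable [FiniteDimensional ℝ E] [MeasurableSpace E] [BorelSpace E]

/-- The `W^{1,1}` norm of a function on the whole space. -/
noncomputable def sobolevNorm (φ : E → ℝ) : ℝ :=
  (∫ x, ‖φ x‖) + ∫ x, ‖fderiv ℝ φ x‖

theorem sobolevNorm_nonneg (φ : E → ℝ) : 0 ≤ sobolevNorm φ :=
  add_nonneg (integral_nonneg fun _ => norm_nonneg _) (integral_nonneg fun _ => norm_nonneg _)

theorem integral_norm_le_sobolevNorm (φ : E → ℝ) : ∫ x, ‖φ x‖ ≤ sobolevNorm φ :=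
  le_add_of_nonneg_right (integral_nonneg fun _ => norm_nonneg _)

theorem IsTest.integrable_mul {L : Set E} (hL : IsCompact L) {φ : E → ℝ} (h : IsTest L φ)
    {u : E → ℝ} (hu : Continuous u) : Integrable fun x => u x * φ x :=
  (hu.mul h.1.continuous).integrable_of_hasCompactSupport (h.hasCompactSupport hL).mul_left

theorem IsTest.integrable_mul_fderiv {L : Set E} (hL : IsCompact L) {φ : E → ℝ} (h : IsTest L φ)
    {u : E → ℝ} (hu : Continuous u) (d : E) : Integrable fun x => u x * fderiv ℝ φ x d := by
  refine (hu.mul (h.continuous_fderiv.clm_apply continuous_const)).integrable_of_hasCompactSupport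
    (HasCompactSupport.mul_left ?_)
  exact ((h.hasCompactSupport hL).fderiv (𝕜 := ℝ)).comp_left
    (g := fun T : E →L[ℝ] ℝ => T d) (by simp)

theorem IsTest.integrable_norm {L : Set E} (hL : IsCompact L) {φ : E → ℝ} (h : IsTest L φ) :
    Integrable fun x => ‖φ x‖ :=
  (h.1.continuous.integrable_of_hasCompactSupport (h.hasCompactSupport hL)).norm

theorem IsTest.integrable_norm_fderiv {L : Set E} (hL : IsCompact L) {φ : E → ℝ}
    (h : IsTest L φ) : Integrable fun x => ‖fderiv ℝ φ x‖ :=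
  (h.continuous_fderiv.integrable_of_hasCompactSupport
    ((h.hasCompactSupport hL).fderiv (𝕜 := ℝ))).norm

/-- Integration by parts against a compactly supported function. -/
theorem IsTest.integral_mul_fderiv {L : Set E} (hL : IsCompact L) {φ : E → ℝ} (h : IsTest L φ)
    {u : E → ℝ} (hu : ContDiff ℝ 1 u) (d : E) :
    ∫ x, u x * fderiv ℝ φ x d = -∫ x, fderiv ℝ u x d * φ x :=
  integral_mul_fderiv_eq_neg_fderiv_mul_of_integrable
    (h.integrable_mul hL ((hu.continuous_fderiv one_ne_zero).clm_apply continuous_const))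
    (h.integrable_mul_fderiv hL hu.continuous d) (h.integrable_mul hL hu.continuous)
    (fun _ _ => (hu.differentiable one_ne_zero) _)
    (fun _ _ => (h.1.differentiable one_ne_zero) _)

/-- A `C¹` function is a multiplier of the `W^{1,1}` norm of functions supported in a compact
set. -/
theorem exists_integral_norm_fderiv_mul_le {L : Set E} (hL : IsCompact L) {u : E → ℝ}
    (hu : ContDiff ℝ 1 u) : ∃ C : ℝ, 0 ≤ C ∧ ∀ φ, IsTest L φ →
      (∫ x, ‖u x * φ x‖ ≤ C * sobolevNorm φ) ∧
      ∫ x, ‖fderiv ℝ (fun y => u y * φ y) x‖ ≤ C * sobolevNorm φ := by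
  obtain ⟨C₁, hC₁⟩ := hL.exists_bound_of_continuousOn hu.continuous.continuousOn
  obtain ⟨C₂, hC₂⟩ := hL.exists_bound_of_continuousOn
    (hu.continuous_fderiv one_ne_zero).continuousOn
  set C := max 0 (max C₁ C₂) with hC
  have hC0 : 0 ≤ C := le_max_left _ _
  have h1 : ∀ x ∈ L, ‖u x‖ ≤ C := fun x hx =>
    (hC₁ x hx).trans ((le_max_left _ _).trans (le_max_right _ _))
  have h2 : ∀ x ∈ L, ‖fderiv ℝ u x‖ ≤ C := fun x hx =>
    (hC₂ x hx).trans ((le_max_right _ _).trans (le_max_right _ _))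
  refine ⟨C, hC0, fun φ hφ => ⟨?_, ?_⟩⟩
  · refine le_trans ?_ (mul_le_mul_of_nonneg_left (integral_norm_le_sobolevNorm φ) hC0)
    rw [← integral_const_mul]
    refine integral_mono (hφ.mul_left hu |>.integrable_norm hL)
      ((hφ.integrable_norm hL).const_mul C) fun x => ?_
    by_cases hx : x ∈ L
    · simpa only [norm_mul] using mul_le_mul_of_nonneg_right (h1 x hx) (norm_nonneg _)
    · simp [hφ.eq_zero hx]
  · have hint := (hφ.integrable_norm hL).add (hφ.integrable_norm_fderiv hL)
    rw [sobolevNorm, ← integral_add (hφ.integrable_norm hL) (hφ.integrable_norm_fderiv hL),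
      ← integral_const_mul]
    refine integral_mono (hφ.mul_left hu |>.integrable_norm_fderiv hL)
      (hint.const_mul C) fun x => ?_
    by_cases hx : x ∈ L
    · simp only
      rw [fderiv_fun_mul (hu.differentiable one_ne_zero x) (hφ.1.differentiable one_ne_zero x)]
      refine (norm_add_le _ _).trans ?_
      rw [norm_smul, norm_smul, mul_add, add_comm]
      refine add_le_add ?_ ?_
      · rw [mul_comm]
        exact mul_le_mul_of_nonneg_right (h2 x hx) (norm_nonneg _)
      · exact mul_le_mul_of_nonneg_right (h1 x hx) (norm_nonneg _)
    · simp only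
      rw [(hφ.mul_left hu).fderiv_eq_zero hx]
      simpa using mul_nonneg hC0 (by positivity)

/-- A fixed periodic function with frequency `c` minus its mean is of order `1 / c` in the dual of
`W^{1,1}`. -/
theorem abs_integral_oscillation_le {L : Set E} (hL : IsCompact L) {g : ℝ → ℝ} (hg : Continuous g)
    (hper : Function.Periodic g 1) (h0 : ∀ t, 0 ≤ g t) (h1 : ∀ t, g t ≤ 1) {ξ : E} (hξ : ξ ≠ 0)
    {c : ℝ} (hc : 0 < c) {ψ : E → ℝ} (hψ : IsTest L ψ) :
    |∫ x, (g (c * inner ℝ ξ x) - ∫ r in (0 : ℝ)..1, g r) * ψ x|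
      ≤ (1 / (c * ‖ξ‖)) * ∫ x, ‖fderiv ℝ ψ x‖ := by
  set m := ∫ r in (0 : ℝ)..1, g r with hm
  have hgm : Continuous fun s => g s - m := by fun_prop
  have hder : ∀ t, HasDerivAt (fun t => ∫ s in (0 : ℝ)..t, (g s - m)) (g t - m) t := fun t =>
    intervalIntegral.integral_hasDerivAt_right (hgm.intervalIntegrable _ _)
      (hgm.stronglyMeasurableAtFilter _ _) hgm.continuousAt
  -- `P` is bounded by `1`, while its derivative along `ξ` is `c ‖ξ‖ ^ 2` times the oscillation.
  -- Integrating by parts along `ξ` gains the factor `1 / c`.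
  set P : E → ℝ := fun y => ∫ s in (0 : ℝ)..(c * inner ℝ ξ y), (g s - m) with hP
  have hPd : ∀ x, HasFDerivAt P ((g (c * inner ℝ ξ x) - m) • c • innerSL ℝ ξ) x := fun x =>
    hasFDerivAt_comp_inner ξ c x (hder _)
  have hPf : fderiv ℝ P = fun x => (g (c * inner ℝ ξ x) - m) • c • innerSL ℝ ξ :=
    funext fun x => (hPd x).fderiv
  have hPC : ContDiff ℝ 1 P := by
    rw [contDiff_one_iff_fderiv]
    refine ⟨fun x => (hPd x).differentiableAt, ?_⟩
    rw [hPf]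
    fun_prop
  have hPb : ∀ x, ‖P x‖ ≤ 1 := fun x => abs_integral_sub_mean_le_one hg hper h0 h1 _
  have hξ' : 0 < ‖ξ‖ := norm_pos_iff.2 hξ
  have key := hψ.integral_mul_fderiv hL hPC ξ
  have hrew : ∀ x, fderiv ℝ P x ξ * ψ x
      = (c * ‖ξ‖ ^ 2) * ((g (c * inner ℝ ξ x) - m) * ψ x) := fun x => by
    rw [hPf]
    simp only [smul_apply, innerSL_apply_apply, real_inner_self_eq_norm_sq,
      smul_eq_mul]
    ring
  simp_rw [hrew, integral_const_mul] at key
  have hbound : |∫ x, P x * fderiv ℝ ψ x ξ| ≤ ‖ξ‖ * ∫ x, ‖fderiv ℝ ψ x‖ := by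
    rw [← integral_const_mul, ← Real.norm_eq_abs]
    refine norm_integral_le_of_norm_le ((hψ.integrable_norm_fderiv hL).const_mul _)
      (Eventually.of_forall fun x => ?_)
    rw [norm_mul, mul_comm ‖ξ‖]
    calc ‖P x‖ * ‖fderiv ℝ ψ x ξ‖ ≤ 1 * (‖fderiv ℝ ψ x‖ * ‖ξ‖) := by
          gcongr
          · exact hPb x
          · exact (fderiv ℝ ψ x).le_opNorm ξ
      _ = _ := one_mul _
  rw [key, abs_neg, abs_mul, abs_of_pos (by positivity : 0 < c * ‖ξ‖ ^ 2)] at hbound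
  rw [div_mul_eq_mul_div, one_mul, le_div_iff₀ (by positivity)]
  refine le_of_mul_le_mul_left ?_ hξ'
  calc _ = c * ‖ξ‖ ^ 2 * |∫ x, (g (c * inner ℝ ξ x) - m) * ψ x| := by ring
    _ ≤ _ := hbound

/-- Periodic functions with growing frequencies, whose means converge to `m`, converge to `m` in
the dual of `W^{1,1}`, also after multiplication by a `C¹` function. -/
theorem eventually_abs_integral_mul_oscillation_le {L : Set E} (hL : IsCompact L) {g : ℕ → ℝ → ℝ}
    (hg : ∀ k, Continuous (g k)) (hper : ∀ k, Function.Periodic (g k) 1)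
    (h0 : ∀ k t, 0 ≤ g k t) (h1 : ∀ k t, g k t ≤ 1) {m : ℝ}
    (hm : Tendsto (fun k => ∫ r in (0 : ℝ)..1, g k r) atTop (𝓝 m)) {ξ : E} (hξ : ξ ≠ 0)
    {u : E → ℝ} (hu : ContDiff ℝ 1 u) {ε : ℝ} (hε : 0 < ε) :
    ∀ᶠ k : ℕ in atTop, ∀ φ, IsTest L φ →
      |∫ x, (u x * (g k (k * inner ℝ ξ x) - m)) * φ x| ≤ ε * sobolevNorm φ := by
  obtain ⟨C, hC0, hC⟩ := exists_integral_norm_fderiv_mul_le hL hu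
  -- The first term is the cost of finite frequency, the second that of the mean of `g k` not yet
  -- being `m`.
  have hlim : Tendsto (fun k : ℕ => (1 / ((k : ℝ) * ‖ξ‖)) * C
      + |(∫ r in (0 : ℝ)..1, g k r) - m| * C) atTop (𝓝 (0 * C + |m - m| * C)) := by
    refine Tendsto.add (Tendsto.mul_const _ ?_) (Tendsto.mul_const _ ?_)
    · simp_rw [one_div]
      exact (tendsto_natCast_atTop_atTop.atTop_mul_const (norm_pos_iff.2 hξ)).inv_tendsto_atTop
    · exact (hm.sub_const m).abs
  simp only [zero_mul, sub_self, abs_zero, add_zero] at hlim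
  filter_upwards [hlim.eventually_lt_const hε, eventually_gt_atTop 0] with k hk hk0 φ hφ
  set mk := ∫ r in (0 : ℝ)..1, g k r
  have hkp : (0 : ℝ) < k := by exact_mod_cast hk0
  have hψ : IsTest L fun x => u x * φ x := hφ.mul_left hu
  have hgc : Continuous fun x : E => g k (k * inner ℝ ξ x) - mk := by
    have := hg k
    fun_prop
  have hsplit : ∫ x, (u x * (g k (k * inner ℝ ξ x) - m)) * φ x
      = (∫ x, (g k (k * inner ℝ ξ x) - mk) * (u x * φ x)) + (mk - m) * ∫ x, u x * φ x := by
    rw [← integral_const_mul, ← integral_add (hψ.integrable_mul hL hgc)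
      (hψ.integrable_mul hL continuous_const)]
    congr 1
    ext x
    ring
  rw [hsplit]
  refine (abs_add_le _ _).trans ?_
  have e1 := abs_integral_oscillation_le hL (hg k) (hper k) (h0 k) (h1 k) hξ hkp hψ
  have e2 : |∫ x, u x * φ x| ≤ C * sobolevNorm φ :=
    (norm_integral_le_integral_norm _).trans (hC φ hφ).1
  have hS := sobolevNorm_nonneg φ
  calc _ ≤ (1 / (k * ‖ξ‖)) * (C * sobolevNorm φ) + |mk - m| * (C * sobolevNorm φ) := by
        rw [abs_mul]
        gcongr
        exact e1.trans (mul_le_mul_of_nonneg_left (hC φ hφ).2 (by positivity))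
    _ = ((1 / (k * ‖ξ‖)) * C + |mk - m| * C) * sobolevNorm φ := by ring
    _ ≤ ε * sobolevNorm φ := mul_le_mul_of_nonneg_right hk.le hS

/-- Smooth functions with values in `[0, 1]`, that depend on `⟪ξ, x⟫` only, are essentially
`{0, 1}`-valued, and oscillate with mean `θ`. -/
theorem exists_oscillation {θ : ℝ} (hθ : θ ∈ Set.Ioo (0 : ℝ) 1) {ξ : E} (hξ : ξ ≠ 0) :
    ∃ ω : ℕ → E → ℝ, (∀ k, ContDiff ℝ (⊤ : ℕ∞) (ω k)) ∧ (∀ k x, 0 ≤ ω k x) ∧ (∀ k x, ω k x ≤ 1) ∧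
      (∀ k x d, inner ℝ ξ d = 0 → fderiv ℝ (ω k) x d = 0) ∧
      (∀ L : Set E, IsCompact L → ∀ u : E → ℝ, ContDiff ℝ 1 u → ∀ ε > 0, ∀ᶠ k in atTop,
        ∀ φ, IsTest L φ → |∫ x, (u x * (ω k x - θ)) * φ x| ≤ ε * sobolevNorm φ) ∧
      (∀ L : Set E, IsCompact L → ∀ ε > 0, ∀ᶠ k in atTop,
        ∀ φ, IsTest L φ → |∫ x, (ω k x * (1 - ω k x)) * φ x| ≤ ε * sobolevNorm φ) := by
  refine ⟨fun k x => profile θ k (k * inner ℝ ξ x), fun k => ?_, fun k x => profile_nonneg _ _ _,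
    fun k x => profile_le_one _ _ _, fun k x d hd => ?_, fun L hL u hu ε hε => ?_,
    fun L hL ε hε => ?_⟩
  · exact (profile_contDiff θ k).comp (contDiff_const.mul ((innerSL ℝ ξ).contDiff))
  · have hd' := ((profile_contDiff θ k).differentiable (by simp)).differentiableAt.hasDerivAt
      (x := k * inner ℝ ξ x)
    rw [(hasFDerivAt_comp_inner ξ k x hd').fderiv]
    simp [hd]
  · refine eventually_abs_integral_mul_oscillation_le hL
      (fun k => (profile_contDiff θ k).continuous) (profile_periodic θ) (profile_nonneg θ)
      (profile_le_one θ) ?_ hξ hu hε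
    have := tendsto_integral_comp_profile hθ continuous_id
      (fun s hs => by simpa [abs_of_nonneg hs.1] using hs.2) rfl
    simpa using this
  · have hb : ∀ s ∈ Set.Icc (0 : ℝ) 1, 0 ≤ s * (1 - s) ∧ s * (1 - s) ≤ 1 := fun s hs =>
      ⟨mul_nonneg hs.1 (by linarith [hs.2]), by nlinarith [hs.1, hs.2]⟩
    have hmem : ∀ k t, profile θ k t ∈ Set.Icc (0 : ℝ) 1 := fun k t =>
      ⟨profile_nonneg θ k t, profile_le_one θ k t⟩
    -- `s (1 - s)` vanishes at `0` and at `1`, so its mean along the profile tends to zero.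
    have := tendsto_integral_comp_profile hθ (f := fun s => s * (1 - s)) (by fun_prop)
      (fun s hs => by rw [abs_of_nonneg (hb s hs).1]; exact (hb s hs).2) (by simp)
    have key := eventually_abs_integral_mul_oscillation_le hL
      (g := fun k t => profile θ k t * (1 - profile θ k t)) (m := 0)
      (fun k => by have := (profile_contDiff θ k).continuous; fun_prop)
      (fun k t => by simp only [profile_periodic θ k t])
      (fun k t => (hb _ (hmem k t)).1) (fun k t => (hb _ (hmem k t)).2) (by simpa using this) hξ
      (u := fun _ => 1) contDiff_const hε
    simpa using key

end Oscillation

/-! ### Iterated laminates -/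

section Laminate

variable {m n : ℕ}

/-- An infinite sequence of splittings `C k = (1 - θ k) A k + θ k C (k + 1)` along directions
admissible for the divergence, with `A k ∈ K` and all matrices bounded by `R`. -/
structure IsSplittingSequence (K : Set (Matrix (Fin m) (Fin n) ℝ))
    (A C : ℕ → Matrix (Fin m) (Fin n) ℝ) (θ : ℕ → ℝ) (ξ : ℕ → EuclideanSpace ℝ (Fin n))
    (R : ℝ) : Prop where
  mem : ∀ k, A k ∈ K
  theta_mem : ∀ k, θ k ∈ Set.Ioo (0 : ℝ) 1
  direction_ne_zero : ∀ k, ξ k ≠ 0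
  split : ∀ k, C k = (1 - θ k) • A k + θ k • C (k + 1)
  kernel : ∀ k i, ∑ j, (C (k + 1) - A k) i j * ξ k j = 0
  norm_le : ∀ a ∈ K, ‖a‖ ≤ R
  norm_center_le : ∀ k, ‖C k‖ ≤ R

/-- The field `B` is the `k`-th iterated laminate up to the error `ε`: it is close to the set `K`
where `v` and `e` are small, and equal to `C k` where `v = 1`. -/
structure IsLaminate (K : Set (Matrix (Fin m) (Fin n) ℝ)) (C : ℕ → Matrix (Fin m) (Fin n) ℝ)
    (θ : ℕ → ℝ) (R : ℝ) (L : Set (EuclideanSpace ℝ (Fin n))) (k : ℕ) (ε : ℝ)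
    (B : EuclideanSpace ℝ (Fin n) → Matrix (Fin m) (Fin n) ℝ)
    (v e : EuclideanSpace ℝ (Fin n) → ℝ) : Prop where
  continuous : Continuous B
  contDiff : ContDiff ℝ (⊤ : ℕ∞) v
  continuous_error : Continuous e
  nonneg : ∀ x, 0 ≤ v x
  le_one : ∀ x, v x ≤ 1
  norm_le : ∀ x, ‖B x - v x • C k‖ ≤ (1 - v x) * R
  close : ∀ x, ∃ a ∈ K, ‖B x - v x • C k - (1 - v x) • a‖ ≤ e x
  div_le : ∀ φ, IsTest L φ → ∀ i,
    |∫ x, ∑ j, B x i j * fderiv ℝ φ x (EuclideanSpace.single j 1)| ≤ ε * sobolevNorm φ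
  mean_le : ∀ φ, IsTest L φ → ∀ i j, |∫ x, (B x i j - C 0 i j) * φ x| ≤ ε * sobolevNorm φ
  fraction_le : ∀ φ, IsTest L φ →
    |∫ x, (v x - ∏ j ∈ Finset.range k, θ j) * φ x| ≤ ε * sobolevNorm φ
  -- `v (1 - v)` detects where `v` is neither `0` nor `1`. Signed test functions are excluded here
  -- because these bounds come from integrating pointwise inequalities.
  transition_le : ∀ φ, IsTest L φ → (∀ x, 0 ≤ φ x) →
    ∫ x, (v x * (1 - v x)) * φ x ≤ ε * sobolevNorm φ
  error_le : ∀ φ, IsTest L φ → (∀ x, 0 ≤ φ x) → ∫ x, e x * φ x ≤ ε * sobolevNorm φ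

variable {K : Set (Matrix (Fin m) (Fin n) ℝ)} {A C : ℕ → Matrix (Fin m) (Fin n) ℝ} {θ : ℕ → ℝ}
  {ξ : ℕ → EuclideanSpace ℝ (Fin n)} {R : ℝ} {L : Set (EuclideanSpace ℝ (Fin n))}

theorem IsSplittingSequence.bound_nonneg (h : IsSplittingSequence K A C θ ξ R) : 0 ≤ R :=
  (norm_nonneg _).trans (h.norm_center_le 0)

/-- Turns a row of a constant matrix into a direction, so that the kernel condition reads as
orthogonality to `ξ`. -/
theorem sum_mul_fderiv_single (d : Fin n → ℝ) (T : EuclideanSpace ℝ (Fin n) →L[ℝ] ℝ) :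
    ∑ j, d j * T (EuclideanSpace.single j 1) = T (WithLp.toLp 2 d) := by
  have : WithLp.toLp 2 d = ∑ j, d j • EuclideanSpace.single j (1 : ℝ) := by
    ext i
    simp [Finset.sum_apply, Pi.single_apply]
  rw [this, map_sum]
  simp

theorem continuous_entry {X : Type*} [TopologicalSpace X] {B : X → Matrix (Fin m) (Fin n) ℝ}
    (hB : Continuous B) (i : Fin m) (j : Fin n) : Continuous fun x => B x i j :=
  hB.matrix_elem i j

theorem IsSplittingSequence.isLaminate_zero (h : IsSplittingSequence K A C θ ξ R)
    (hL : IsCompact L) {ε : ℝ} (hε : 0 ≤ ε) :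
    IsLaminate K C θ R L 0 ε (fun _ => C 0) (fun _ => 1) (fun _ => 0) where
  continuous := continuous_const
  contDiff := contDiff_const
  continuous_error := continuous_const
  nonneg _ := zero_le_one
  le_one _ := le_rfl
  norm_le _ := by simp
  close _ := ⟨A 0, h.mem 0, by simp⟩
  div_le φ hφ i := by
    simp_rw [sum_mul_fderiv_single (fun j => C 0 i j)]
    have := hφ.integral_mul_fderiv hL (u := fun _ => (1 : ℝ)) contDiff_const
      (WithLp.toLp 2 fun j => C 0 i j)
    simp only [one_mul] at this
    rw [this]
    simpa using mul_nonneg hε (sobolevNorm_nonneg φ)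
  mean_le φ _ i j := by simpa using mul_nonneg hε (sobolevNorm_nonneg φ)
  fraction_le φ _ := by simpa using mul_nonneg hε (sobolevNorm_nonneg φ)
  transition_le φ _ _ := by simpa using mul_nonneg hε (sobolevNorm_nonneg φ)
  error_le φ _ _ := by simpa using mul_nonneg hε (sobolevNorm_nonneg φ)

/-- Integration by parts for a modulation `ω - θ` which is constant in the direction `d`. -/
theorem integral_mul_sub_mul_fderiv (hL : IsCompact L) {φ v ω : EuclideanSpace ℝ (Fin n) → ℝ}
    (hφ : IsTest L φ) (hv : ContDiff ℝ 1 v) (hω : ContDiff ℝ 1 ω)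
    {d : EuclideanSpace ℝ (Fin n)} (hd : ∀ x, fderiv ℝ ω x d = 0) (t : ℝ) :
    ∫ x, (v x * (ω x - t)) * fderiv ℝ φ x d = -∫ x, (fderiv ℝ v x d * (ω x - t)) * φ x := by
  rw [hφ.integral_mul_fderiv hL (hv.mul (hω.sub contDiff_const))]
  congr 2
  ext x
  congr 1
  rw [fderiv_fun_mul (hv.differentiable one_ne_zero x)
    ((hω.differentiable one_ne_zero x).sub_const t), fderiv_sub_const]
  simp [hd x, mul_comm]

/-- Refining a laminate by one more splitting, where `ω` has to oscillate fast enough. -/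
theorem IsLaminate.refine (h : IsSplittingSequence K A C θ ξ R) (hL : IsCompact L) {k : ℕ}
    {ε δ : ℝ} (hδ : δ ≤ ε / 2) (hδR : (1 + 4 * R) * δ ≤ ε)
    {B : EuclideanSpace ℝ (Fin n) → Matrix (Fin m) (Fin n) ℝ}
    {v e ω : EuclideanSpace ℝ (Fin n) → ℝ} (hB : IsLaminate K C θ R L k δ B v e)
    (hω : ContDiff ℝ (⊤ : ℕ∞) ω) (hω0 : ∀ x, 0 ≤ ω x) (hω1 : ∀ x, ω x ≤ 1)
    (hωd : ∀ x d, inner ℝ (ξ k) d = 0 → fderiv ℝ ω x d = 0)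
    (hdiv : ∀ i φ, IsTest L φ →
      |∫ x, (fderiv ℝ v x (WithLp.toLp 2 ((C (k + 1) - A k) i)) * (ω x - θ k)) * φ x|
        ≤ ε / 2 * sobolevNorm φ)
    (hmean : ∀ i j φ, IsTest L φ →
      |∫ x, ((v x * (C (k + 1) - A k) i j) * (ω x - θ k)) * φ x| ≤ ε / 2 * sobolevNorm φ)
    (hfrac : ∀ φ, IsTest L φ → |∫ x, (v x * (ω x - θ k)) * φ x| ≤ ε / 2 * sobolevNorm φ)
    (htrans : ∀ φ, IsTest L φ → |∫ x, (ω x * (1 - ω x)) * φ x| ≤ ε / 2 * sobolevNorm φ) :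
    IsLaminate K C θ R L (k + 1) ε
      (fun x => B x + (v x * (ω x - θ k)) • (C (k + 1) - A k)) (fun x => v x * ω x)
      (fun x => e x + 4 * R * (v x * (1 - v x))) := by
  have hR := h.bound_nonneg
  have hBc := hB.continuous
  have hvc := hB.contDiff.continuous
  have hec := hB.continuous_error
  have hωc := hω.continuous
  have hθ := h.theta_mem k
  have hsum : ∀ φ : EuclideanSpace ℝ (Fin n) → ℝ, δ * sobolevNorm φ + ε / 2 * sobolevNorm φ
      ≤ ε * sobolevNorm φ := fun φ => by
    nlinarith [sobolevNorm_nonneg φ]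
  -- The splitting of `C k` cancels `θ k`: the part outside the new centre gains `A k` with weight
  -- `v (1 - ω)`.
  have hpart : ∀ x, B x + (v x * (ω x - θ k)) • (C (k + 1) - A k) - (v x * ω x) • C (k + 1)
      = B x - v x • C k + (v x * (1 - ω x)) • A k := fun x => by
    rw [h.split k]
    module
  have hvω : ∀ x, 0 ≤ v x * (1 - ω x) := fun x =>
    mul_nonneg (hB.nonneg x) (by linarith [hω1 x])
  refine ⟨by fun_prop, hB.contDiff.mul hω, by fun_prop,
    fun x => mul_nonneg (hB.nonneg x) (hω0 x),
    fun x => mul_le_one₀ (hB.le_one x) (hω0 x) (hω1 x), fun x => ?_, fun x => ?_,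
    fun φ hφ i => ?_, fun φ hφ i j => ?_, fun φ hφ => ?_, fun φ hφ hφ0 => ?_,
    fun φ hφ hφ0 => ?_⟩
  · rw [hpart]
    refine (norm_add_le _ _).trans ?_
    rw [norm_smul, Real.norm_of_nonneg (hvω x)]
    have h1 := hB.norm_le x
    have h2 := mul_le_mul_of_nonneg_left (h.norm_le _ (h.mem k)) (hvω x)
    linarith
  · rw [hpart]
    have h0 := hB.nonneg x
    have h1 := hB.le_one x
    have hA := h.norm_le _ (h.mem k)
    -- For `v ≤ 1/2` the old point `a` is kept, at extra cost at most `2 R v`; for `v ≥ 1/2` the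
    -- point `A k` is used, at cost at most `2 R (1 - v)`. Both are at most `4 R v (1 - v)`.
    rcases le_total (v x) (1 / 2) with hv | hv
    · obtain ⟨a, ha, hax⟩ := hB.close x
      refine ⟨a, ha, ?_⟩
      have hrw : B x - v x • C k + (v x * (1 - ω x)) • A k - (1 - v x * ω x) • a
          = (B x - v x • C k - (1 - v x) • a) + (v x * (1 - ω x)) • (A k - a) := by module
      rw [hrw]
      refine (norm_add_le _ _).trans (add_le_add hax ?_)
      rw [norm_smul, Real.norm_of_nonneg (hvω x)]
      have h2 : ‖A k - a‖ ≤ 2 * R := (norm_sub_le _ _).trans (by linarith [h.norm_le a ha])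
      calc v x * (1 - ω x) * ‖A k - a‖ ≤ v x * 1 * (2 * R) := by
            gcongr
            linarith [hω0 x]
        _ ≤ 4 * R * (v x * (1 - v x)) := by
            nlinarith [mul_nonneg (mul_nonneg hR h0) (by linarith : 0 ≤ 1 - 2 * v x)]
    · refine ⟨A k, h.mem k, ?_⟩
      have hrw : B x - v x • C k + (v x * (1 - ω x)) • A k - (1 - v x * ω x) • A k
          = (B x - v x • C k) - (1 - v x) • A k := by module
      rw [hrw]
      refine (norm_sub_le _ _).trans ?_
      rw [norm_smul, Real.norm_of_nonneg (by linarith : 0 ≤ 1 - v x)]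
      have h2 := hB.norm_le x
      have h3 := mul_le_mul_of_nonneg_left hA (by linarith : 0 ≤ 1 - v x)
      have h4 : 0 ≤ e x := by
        obtain ⟨a, -, hax⟩ := hB.close x
        exact (norm_nonneg _).trans hax
      nlinarith [mul_nonneg (mul_nonneg hR (by linarith : 0 ≤ 1 - v x))
        (by linarith : 0 ≤ 2 * v x - 1)]
  · set d := WithLp.toLp 2 ((C (k + 1) - A k) i) with hd
    have hdξ : inner ℝ (ξ k) d = 0 := by
      rw [← h.kernel k i]
      simp [d, PiLp.inner_apply]
    have hsplit : ∀ x, ∑ j, (B x + (v x * (ω x - θ k)) • (C (k + 1) - A k)) i j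
          * fderiv ℝ φ x (EuclideanSpace.single j 1)
        = (∑ j, B x i j * fderiv ℝ φ x (EuclideanSpace.single j 1))
          + (v x * (ω x - θ k)) * fderiv ℝ φ x d := fun x => by
      rw [hd, ← sum_mul_fderiv_single, Finset.mul_sum, ← Finset.sum_add_distrib]
      refine Finset.sum_congr rfl fun j _ => ?_
      simp only [Matrix.add_apply, Matrix.smul_apply, smul_eq_mul]
      ring
    simp_rw [hsplit]
    rw [integral_add (integrable_finsetSum _ fun j _ =>
        hφ.integrable_mul_fderiv hL (continuous_entry hBc i j) _)
      (hφ.integrable_mul_fderiv hL (by fun_prop) _),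
      integral_mul_sub_mul_fderiv hL hφ (hB.contDiff.of_le (by simp)) (hω.of_le (by simp))
        (fun x => hωd x d hdξ)]
    refine (abs_add_le _ _).trans ((add_le_add (hB.div_le φ hφ i) ?_).trans (hsum φ))
    rw [abs_neg]
    exact hdiv i φ hφ
  · have hsplit : ∀ x, ((B x + (v x * (ω x - θ k)) • (C (k + 1) - A k)) i j - C 0 i j) * φ x
        = (B x i j - C 0 i j) * φ x
          + ((v x * (C (k + 1) - A k) i j) * (ω x - θ k)) * φ x := fun x => by
      simp only [Matrix.add_apply, Matrix.smul_apply, smul_eq_mul]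
      ring
    simp_rw [hsplit]
    have hBij : Continuous fun x => B x i j := continuous_entry hBc i j
    rw [integral_add (hφ.integrable_mul hL (u := fun x => B x i j - C 0 i j) (by fun_prop))
      (hφ.integrable_mul hL
        (u := fun x => (v x * (C (k + 1) - A k) i j) * (ω x - θ k)) (by fun_prop))]
    exact (abs_add_le _ _).trans
      ((add_le_add (hB.mean_le φ hφ i j) (hmean i j φ hφ)).trans (hsum φ))
  · set p := ∏ j ∈ Finset.range k, θ j
    have hsplit : ∀ x, (v x * ω x - ∏ j ∈ Finset.range (k + 1), θ j) * φ x
        = θ k * ((v x - p) * φ x) + (v x * (ω x - θ k)) * φ x := fun x => by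
      rw [Finset.prod_range_succ]
      ring
    simp_rw [hsplit]
    rw [integral_add ((hφ.integrable_mul hL (by fun_prop)).const_mul _)
      (hφ.integrable_mul hL (by fun_prop)), integral_const_mul]
    refine (abs_add_le _ _).trans ((add_le_add ?_ (hfrac φ hφ)).trans (hsum φ))
    rw [abs_mul, abs_of_pos hθ.1]
    exact (mul_le_of_le_one_left (abs_nonneg _) hθ.2.le).trans (hB.fraction_le φ hφ)
  · refine le_trans ?_ ((add_le_add (hB.transition_le φ hφ hφ0)
      ((le_abs_self _).trans (htrans φ hφ))).trans (hsum φ))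
    rw [← integral_add (hφ.integrable_mul hL (by fun_prop))
      (hφ.integrable_mul hL (by fun_prop))]
    refine integral_mono (hφ.integrable_mul hL (by fun_prop))
      ((hφ.integrable_mul hL (by fun_prop)).add (hφ.integrable_mul hL (by fun_prop)))
      fun x => ?_
    simp only
    rw [← add_mul]
    refine mul_le_mul_of_nonneg_right ?_ (hφ0 x)
    have a0 := hB.nonneg x
    have a1 : 0 ≤ 1 - v x := by linarith [hB.le_one x]
    have b0 := hω0 x
    have b1 : 0 ≤ 1 - ω x := by linarith [hω1 x]
    -- the difference is `v (1 - v) (1 - ω) + ω (1 - ω) (1 - v ^ 2)`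
    nlinarith [mul_nonneg (mul_nonneg a0 a1) b1, mul_nonneg (mul_nonneg b0 b1)
      (mul_nonneg a1 (by linarith : 0 ≤ 1 + v x))]
  · simp_rw [add_mul, mul_assoc (4 * R)]
    rw [integral_add (hφ.integrable_mul hL hec)
      ((hφ.integrable_mul hL (by fun_prop)).const_mul _), integral_const_mul]
    have h1 := hB.error_le φ hφ hφ0
    have h2 := mul_le_mul_of_nonneg_left (hB.transition_le φ hφ hφ0)
      (by positivity : 0 ≤ 4 * R)
    have h3 := mul_le_mul_of_nonneg_right hδR (sobolevNorm_nonneg φ)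
    linarith

/-- Iterated laminates of every order exist. -/
theorem IsSplittingSequence.exists_isLaminate (h : IsSplittingSequence K A C θ ξ R)
    (hL : IsCompact L) (k : ℕ) : ∀ ε > 0, ∃ B v e, IsLaminate K C θ R L k ε B v e := by
  induction k with
  | zero => exact fun ε hε => ⟨_, _, _, h.isLaminate_zero hL hε.le⟩
  | succ k ih =>
    intro ε hε
    have hR := h.bound_nonneg
    -- This tolerance is at most `ε / 2`, and stays below `ε` after multiplication by `1 + 4 R`, the
    -- growth of the bound for `e`.
    obtain ⟨B, v, e, hB⟩ := ih (ε / (4 * R + 2)) (by positivity)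
    have hv1 : ContDiff ℝ 1 v := hB.contDiff.of_le (by simp)
    have hv' : ∀ d, ContDiff ℝ 1 fun x => fderiv ℝ v x d := fun d =>
      (hB.contDiff.fderiv_right (m := 1) (WithTop.coe_le_coe.2 le_top)).clm_apply contDiff_const
    obtain ⟨ω, hω, hω0, hω1, hωd, hosc, htr⟩ :=
      exists_oscillation (h.theta_mem k) (h.direction_ne_zero k)
    have hε2 : 0 < ε / 2 := by positivity
    -- With `v` already fixed, only finitely many coefficients occur, so one frequency serves all
    -- estimates.
    have e1 := eventually_all.2 fun i : Fin m => hosc L hL _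
      (hv' (WithLp.toLp 2 ((C (k + 1) - A k) i))) _ hε2
    have e2 := eventually_all.2 fun i : Fin m => eventually_all.2 fun j : Fin n => hosc L hL _
      (hv1.mul (contDiff_const (c := (C (k + 1) - A k) i j))) _ hε2
    obtain ⟨l, h1, h2, h3, h4⟩ := (e1.and (e2.and ((hosc L hL v hv1 _ hε2).and
      (htr L hL _ hε2)))).exists
    refine ⟨_, _, _, IsLaminate.refine h hL ?_ ?_ hB (hω l) (hω0 l) (hω1 l) (hωd l) h1 h2 h3 h4⟩
    · gcongr
      linarith
    · rw [mul_div_assoc', div_le_iff₀ (by positivity)]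
      nlinarith

/-- If the volume fractions of the centres tend to zero, the iterated laminates are almost
divergence free, almost in `K`, and weakly close to `C 0`. -/
theorem IsSplittingSequence.exists_almost_solution (h : IsSplittingSequence K A C θ ξ R)
    (hprod : Tendsto (fun k => ∏ j ∈ Finset.range k, θ j) atTop (𝓝 0))
    (hL : IsCompact L) {ε : ℝ} (hε : 0 < ε) :
    ∃ B : EuclideanSpace ℝ (Fin n) → Matrix (Fin m) (Fin n) ℝ, Continuous B ∧ (∀ x, ‖B x‖ ≤ R) ∧
      ∀ φ, IsTest L φ →
        (∀ i, |∫ x, ∑ j, B x i j * fderiv ℝ φ x (EuclideanSpace.single j 1)|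
          ≤ ε * sobolevNorm φ) ∧
        (∀ i j, |∫ x, (B x i j - C 0 i j) * φ x| ≤ ε * sobolevNorm φ) ∧
        ((∀ x, 0 ≤ φ x) → ∫ x, Metric.infDist (B x) K * φ x ≤ ε * sobolevNorm φ) := by
  have hR := h.bound_nonneg
  -- The distance to `K` is at most `e + 2 R v`. The first term costs `δ`, and the second `2 R (δ +
  -- δ)`: one `δ` for the error of `v`, one for its limiting fraction `p < δ`.
  set δ := ε / (1 + 4 * R) with hδ
  have hδ0 : 0 < δ := by positivity
  have hδε : δ ≤ ε := div_le_self hε.le (by linarith)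
  obtain ⟨k, hk⟩ := (hprod.eventually_lt_const hδ0).exists
  obtain ⟨B, v, e, hB⟩ := h.exists_isLaminate hL k δ hδ0
  have hvc := hB.contDiff.continuous
  have hec := hB.continuous_error
  refine ⟨B, hB.continuous, fun x => ?_, fun φ hφ => ?_⟩
  · have h1 : ‖v x • C k‖ ≤ v x * R := by
      rw [norm_smul, Real.norm_of_nonneg (hB.nonneg x)]
      exact mul_le_mul_of_nonneg_left (h.norm_center_le k) (hB.nonneg x)
    have h2 := norm_add_le (B x - v x • C k) (v x • C k)
    rw [sub_add_cancel] at h2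
    linarith [hB.norm_le x]
  · have hmono := mul_le_mul_of_nonneg_right hδε (sobolevNorm_nonneg φ)
    refine ⟨fun i => (hB.div_le φ hφ i).trans hmono,
      fun i j => (hB.mean_le φ hφ i j).trans hmono, fun hφ0 => ?_⟩
    set p := ∏ j ∈ Finset.range k, θ j
    have hpt : ∀ x, Metric.infDist (B x) K ≤ e x + 2 * R * v x := fun x => by
      obtain ⟨a, ha, hax⟩ := hB.close x
      refine (Metric.infDist_le_dist_of_mem ha).trans ?_
      rw [dist_eq_norm]
      have hrw : B x - a = (B x - v x • C k - (1 - v x) • a) + v x • (C k - a) := by module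
      rw [hrw]
      refine (norm_add_le _ _).trans (add_le_add hax ?_)
      rw [norm_smul, Real.norm_of_nonneg (hB.nonneg x), mul_comm]
      refine mul_le_mul_of_nonneg_right ((norm_sub_le _ _).trans ?_) (hB.nonneg x)
      linarith [h.norm_center_le k, h.norm_le a ha]
    have hint : ∫ x, Metric.infDist (B x) K * φ x
        ≤ ∫ x, (e x * φ x + 2 * R * ((v x - p) * φ x + p * φ x)) := by
      refine integral_mono
        (hφ.integrable_mul hL ((Metric.continuous_infDist_pt K).comp hB.continuous))
        ((hφ.integrable_mul hL hec).add (((hφ.integrable_mul hL (by fun_prop)).add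
          (hφ.integrable_mul hL continuous_const)).const_mul _)) fun x => ?_
      have := mul_le_mul_of_nonneg_right (hpt x) (hφ0 x)
      simp only
      linarith
    refine hint.trans ?_
    have hi1 : Integrable fun x => (v x - p) * φ x := hφ.integrable_mul hL (by fun_prop)
    have hi2 : Integrable fun x => p * φ x := hφ.integrable_mul hL continuous_const
    have hi3 : Integrable fun x => (v x - p) * φ x + p * φ x := hi1.add hi2
    rw [integral_add (hφ.integrable_mul hL hec) (hi3.const_mul _), integral_const_mul,
      integral_add hi1 hi2, integral_const_mul]
    have h1 := hB.error_le φ hφ hφ0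
    have h2 := (le_abs_self _).trans (hB.fraction_le φ hφ)
    have hφi : 0 ≤ ∫ x, φ x := integral_nonneg hφ0
    have h3 : p * ∫ x, φ x ≤ δ * sobolevNorm φ := by
      refine mul_le_mul hk.le ?_ hφi hδ0.le
      refine le_trans (le_of_eq ?_) (integral_norm_le_sobolevNorm φ)
      exact integral_congr_ae (Eventually.of_forall fun x => (Real.norm_of_nonneg (hφ0 x)).symm)
    calc _ ≤ δ * sobolevNorm φ + 2 * R * (δ * sobolevNorm φ + δ * sobolevNorm φ) := by gcongr
      _ = (1 + 4 * R) * δ * sobolevNorm φ := by ring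
      _ = ε * sobolevNorm φ := by
        rw [hδ]
        field_simp

end Laminate

/-! ### From almost solutions to approximate solutions -/

section Nonrigid

variable {m n : ℕ} {K : Set (Matrix (Fin m) (Fin n) ℝ)} {Ω : Opens (EuclideanSpace ℝ (Fin n))}

theorem isTest_testFunction {L : Set (EuclideanSpace ℝ (Fin n))}
    (hΩL : (Ω : Set (EuclideanSpace ℝ (Fin n))) ⊆ L) (φ : 𝓓(Ω, ℝ)) : IsTest L φ :=
  ⟨φ.contDiff.of_le (by exact_mod_cast le_top), φ.tsupport_subset.trans hΩL⟩

theorem sobolevNormOneOne_eq_sobolevNorm (φ : 𝓓(Ω, ℝ)) :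
    sobolevNormOneOne Ω φ = sobolevNorm φ := by
  have hφ := isTest_testFunction subset_rfl φ
  rw [sobolevNormOneOne, sobolevNorm,
    setIntegral_eq_integral_of_forall_compl_eq_zero fun x hx => by rw [hφ.eq_zero hx, norm_zero],
    setIntegral_eq_integral_of_forall_compl_eq_zero fun x hx => by
      rw [hφ.fderiv_eq_zero hx, norm_zero]]

theorem negSobolevNorm_distribDiv_le
    {B : EuclideanSpace ℝ (Fin n) → Matrix (Fin m) (Fin n) ℝ} {i : Fin m} {ε : ℝ} (hε : 0 ≤ ε)
    (h : ∀ φ : 𝓓(Ω, ℝ), |∫ x, ∑ j, B x i j * fderiv ℝ φ x (EuclideanSpace.single j 1)|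
      ≤ ε * sobolevNorm φ) :
    negSobolevNorm Ω (distribDiv Ω B i) ≤ ENNReal.ofReal ε := by
  refine iSup₂_le fun φ hφ => ENNReal.ofReal_le_ofReal ?_
  rw [sobolevNormOneOne_eq_sobolevNorm] at hφ
  rw [distribDiv, abs_neg, setIntegral_eq_integral_of_forall_compl_eq_zero fun x hx => by
    simp [(isTest_testFunction subset_rfl φ).fderiv_eq_zero hx]]
  exact (h φ).trans (mul_le_of_le_one_right hε hφ)

/-- A bounded sequence that converges weakly to `C` cannot converge in measure to a matrix
different from `C`. -/
theorem not_tendstoInMeasure_of_weak_limit (hne : (Ω : Set (EuclideanSpace ℝ (Fin n))).Nonempty)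
    {L : Set (EuclideanSpace ℝ (Fin n))} (hL : IsCompact L)
    (hΩL : (Ω : Set (EuclideanSpace ℝ (Fin n))) ⊆ L)
    {B : ℕ → EuclideanSpace ℝ (Fin n) → Matrix (Fin m) (Fin n) ℝ} (hB : ∀ h, Continuous (B h))
    {R : ℝ} (hR : ∀ h x, ‖B h x‖ ≤ R) {C A : Matrix (Fin m) (Fin n) ℝ} (hAC : A ≠ C)
    (hweak : ∀ φ, IsTest L φ → ∀ i j,
      Tendsto (fun h => ∫ x, (B h x i j - C i j) * φ x) atTop (𝓝 0)) :
    ¬ TendstoInMeasure (vol Ω) (fun h x => dist (B h x) A) atTop (fun _ => (0 : ℝ)) := by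
  intro hT
  obtain ⟨ns, hns, hae⟩ := hT.exists_seq_tendsto_ae
  obtain ⟨x₀, hx₀⟩ := hne
  obtain ⟨ψ, hψΩ, hψc, hψ, hψr, hψx⟩ :=
    exists_contDiff_tsupport_subset (n := 1) (Ω.isOpen.mem_nhds hx₀)
  have hψ0 : ∀ x, 0 ≤ ψ x := fun x => (hψr ⟨x, rfl⟩).1
  have hψ1 : ∀ x, ψ x ≤ 1 := fun x => (hψr ⟨x, rfl⟩).2
  have htest : IsTest L ψ := ⟨by exact_mod_cast hψ, hψΩ.trans hΩL⟩
  have hpos : 0 < ∫ x, ψ x :=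
    hψ.continuous.integral_pos_of_hasCompactSupport_nonneg_nonzero hψc hψ0
      (x := x₀) (by rw [hψx]; exact one_ne_zero)
  have hfin : IsFiniteMeasure (vol Ω) :=
    isFiniteMeasure_restrict.2 ((measure_mono hΩL).trans_lt hL.measure_lt_top).ne
  refine hAC (Matrix.ext fun i j => ?_)
  have hBij : ∀ h, Continuous fun x => B h x i j := fun h => continuous_entry (hB h) i j
  have : ProperSpace (Matrix (Fin m) (Fin n) ℝ) := FiniteDimensional.proper ℝ _
  obtain ⟨b, hb⟩ :=
    (isCompact_closedBall (0 : Matrix (Fin m) (Fin n) ℝ) R).exists_bound_of_continuousOn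
      (f := fun X : Matrix (Fin m) (Fin n) ℝ => X i j)
      (continuous_entry continuous_id i j).continuousOn
  -- The limit of these integrals is computed twice: by dominated convergence along an a.e.
  -- convergent subsequence, then from the weak limit `C`. Since `∫ ψ > 0`, the entries of `A` and
  -- `C` must agree.
  have hlim1 : Tendsto (fun h => ∫ x in (Ω : Set _), (B (ns h) x i j - A i j) * ψ x) atTop
      (𝓝 (∫ x in (Ω : Set (EuclideanSpace ℝ (Fin n))), 0 * ψ x)) := by
    refine tendsto_integral_of_dominated_convergence (fun _ => b + |A i j|)
      (fun h => (((hBij (ns h)).sub continuous_const).mul hψ.continuous).aestronglyMeasurable)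
      (integrable_const _) (fun h => Eventually.of_forall fun x => ?_) ?_
    · rw [norm_mul, Real.norm_of_nonneg (hψ0 x)]
      have h1 : ‖B (ns h) x i j‖ ≤ b := hb _ (by simpa using hR (ns h) x)
      exact (mul_le_of_le_one_right (norm_nonneg _) (hψ1 x)).trans
        ((norm_sub_le _ _).trans (by rw [Real.norm_eq_abs (A i j)]; gcongr))
    · filter_upwards [hae] with x hx
      have hBx : Tendsto (fun h => B (ns h) x) atTop (𝓝 A) :=
        tendsto_iff_dist_tendsto_zero.2 hx
      have hent : Tendsto (fun h => B (ns h) x i j) atTop (𝓝 (A i j)) :=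
        ((continuous_entry continuous_id i j).tendsto A).comp hBx
      have := hent.sub_const (A i j)
      rw [sub_self] at this
      exact this.mul_const _
  have hlim2 : Tendsto (fun h => ∫ x in (Ω : Set _), (B (ns h) x i j - A i j) * ψ x) atTop
      (𝓝 (0 + (C i j - A i j) * ∫ x, ψ x)) := by
    refine (((hweak ψ htest i j).comp hns.tendsto_atTop).add_const _).congr fun h => ?_
    rw [setIntegral_eq_integral_of_forall_compl_eq_zero fun x hx => by
        rw [image_eq_zero_of_notMem_tsupport fun h' => hx (hψΩ h'), mul_zero],
      Function.comp_apply, ← integral_const_mul, ← integral_add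
        (htest.integrable_mul hL (u := fun x => B (ns h) x i j - C i j)
          ((hBij (ns h)).sub continuous_const))
        (htest.integrable_mul hL continuous_const)]
    congr 1
    ext x
    ring
  have heq := tendsto_nhds_unique hlim1 hlim2
  simp only [zero_mul, integral_zero, zero_add] at heq
  rcases mul_eq_zero.1 heq.symm with h | h
  · linarith
  · exact absurd h hpos.ne'

/-- A splitting sequence whose volume fractions have product zero, starting outside of `K`,
generates an approximate solution. -/
theorem IsSplittingSequence.not_isRigid {A C : ℕ → Matrix (Fin m) (Fin n) ℝ} {θ : ℕ → ℝ}
    {ξ : ℕ → EuclideanSpace ℝ (Fin n)} {R : ℝ} (h : IsSplittingSequence K A C θ ξ R)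
    (hprod : Tendsto (fun k => ∏ j ∈ Finset.range k, θ j) atTop (𝓝 0)) (hC : C 0 ∉ K)
    (hne : (Ω : Set (EuclideanSpace ℝ (Fin n))).Nonempty)
    (hbdd : Bornology.IsBounded (Ω : Set (EuclideanSpace ℝ (Fin n)))) :
    ¬ IsRigidForApproximateSolutions Ω K := by
  obtain ⟨r, hr0, hr⟩ := hbdd.subset_closedBall_lt 0 0
  -- As `η = 1` on `Ω`, pairing the distance to `K` with `η` dominates its `L¹` norm on `Ω`.
  let η : ContDiffBump (0 : EuclideanSpace ℝ (Fin n)) := ⟨r, r + 1, hr0, by linarith⟩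
  set L := Metric.closedBall (0 : EuclideanSpace ℝ (Fin n)) (r + 1) with hLdef
  have hL : IsCompact L := isCompact_closedBall _ _
  have hΩL : (Ω : Set (EuclideanSpace ℝ (Fin n))) ⊆ L :=
    hr.trans (Metric.closedBall_subset_closedBall (by linarith))
  have hη : IsTest L η := ⟨η.contDiff, η.tsupport_eq.subset⟩
  have hε : ∀ k : ℕ, (0 : ℝ) < 1 / ((k : ℝ) + 1) := fun k => by positivity
  have hε0 : Tendsto (fun k : ℕ => 1 / ((k : ℝ) + 1)) atTop (𝓝 0) :=
    tendsto_one_div_add_atTop_nhds_zero_nat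
  choose B hBc hBR hB using fun k => h.exists_almost_solution hprod hL (hε k)
  refine not_not.2 ⟨B, ⟨R.toNNReal, fun k => ?_⟩, fun i => ?_, ?_, fun a ha σ hσ => ?_⟩
  · have : PseudoMetrizableSpace (Matrix (Fin m) (Fin n) ℝ) :=
      inferInstanceAs (PseudoMetrizableSpace (Fin m → Fin n → ℝ))
    have hmeas : AEStronglyMeasurable (B k) (vol Ω) := (hBc k).aestronglyMeasurable
    refine ⟨memLp_top_of_bound hmeas R (Eventually.of_forall (hBR k)), ?_⟩
    rw [eLpNorm_exponent_top]
    exact eLpNormEssSup_le_of_ae_bound (Eventually.of_forall (hBR k))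
  · have hlim := ENNReal.tendsto_ofReal hε0
    rw [ENNReal.ofReal_zero] at hlim
    exact tendsto_of_tendsto_of_tendsto_of_le_of_le tendsto_const_nhds hlim
      (fun _ => zero_le) fun k => negSobolevNorm_distribDiv_le (hε k).le fun φ =>
        (hB k φ (isTest_testFunction hΩL φ)).1 i
  · have hcont : ∀ k, Continuous fun x => Metric.infDist (B k x) K := fun k =>
      (Metric.continuous_infDist_pt K).comp (hBc k)
    refine tendstoInMeasure_of_tendsto_eLpNorm (p := 1) one_ne_zero
      (fun k => (hcont k).aestronglyMeasurable) aestronglyMeasurable_const ?_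
    have hlim := ENNReal.tendsto_ofReal (hε0.mul_const (sobolevNorm η))
    rw [zero_mul, ENNReal.ofReal_zero] at hlim
    refine tendsto_of_tendsto_of_tendsto_of_le_of_le tendsto_const_nhds hlim
      (fun _ => zero_le) fun k => ?_
    have hint : Integrable (fun x => Metric.infDist (B k x) K) (vol Ω) :=
      ((hcont k).continuousOn.integrableOn_compact hL).mono_set hΩL
    have hsub : (fun x => Metric.infDist (B k x) K) - (fun _ => (0 : ℝ))
        = fun x => Metric.infDist (B k x) K := by
      ext x
      simp
    simp only
    rw [hsub, eLpNorm_one_eq_lintegral_enorm, ← ofReal_integral_norm_eq_lintegral_enorm hint]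
    refine ENNReal.ofReal_le_ofReal (le_trans ?_ ((hB k η hη).2.2 fun x => η.nonneg))
    refine le_trans (le_of_eq ?_) (setIntegral_le_integral (s := (Ω : Set _))
      (hη.integrable_mul hL (hcont k))
      (Eventually.of_forall fun x => mul_nonneg Metric.infDist_nonneg η.nonneg))
    refine setIntegral_congr_fun Ω.isOpen.measurableSet fun x hx => ?_
    rw [Real.norm_of_nonneg Metric.infDist_nonneg, η.one_of_mem_closedBall (hr hx), mul_one]
  · refine not_tendstoInMeasure_of_weak_limit hne hL hΩL (fun k => hBc (σ k))
      (fun k => hBR (σ k)) (C := C 0) (fun h' => hC (h' ▸ ha)) fun φ hφ i j => ?_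
    have hlim := (hε0.comp hσ.tendsto_atTop).mul_const (sobolevNorm φ)
    rw [zero_mul] at hlim
    exact squeeze_zero_norm (fun k => (hB (σ k) φ hφ).2.1 i j) hlim

/-- A finite set containing a `T₃` configuration for the divergence is non-rigid. -/
theorem not_isRigid_of_cycle (hK : K.Finite) {a c : ZMod 3 → Matrix (Fin m) (Fin n) ℝ}
    {θ : ZMod 3 → ℝ} {ξ : ZMod 3 → Fin n → ℝ} (ha : ∀ i, a i ∈ K)
    (hθ : ∀ i, θ i ∈ Set.Ioo (0 : ℝ) 1) (hξ : ∀ i, ξ i ≠ 0)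
    (hsplit : ∀ i, c i = (1 - θ i) • a i + θ i • c (i + 1))
    (hker : ∀ i, (c (i + 1) - a i).mulVec (ξ i) = 0) (hc : c 0 ∉ K)
    (hne : (Ω : Set (EuclideanSpace ℝ (Fin n))).Nonempty)
    (hbdd : Bornology.IsBounded (Ω : Set (EuclideanSpace ℝ (Fin n)))) :
    ¬ IsRigidForApproximateSolutions Ω K := by
  obtain ⟨R₁, hR₁⟩ := hK.isBounded.exists_norm_le
  obtain ⟨R₂, hR₂⟩ := (Set.finite_range c).isBounded.exists_norm_le
  -- The cycle is unrolled into a 3-periodic sequence through the cast `ℕ → ZMod 3`.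
  have hseq : IsSplittingSequence K (fun k => a k) (fun k => c k) (fun k => θ k)
      (fun k => WithLp.toLp 2 (ξ k)) (max R₁ R₂) :=
    { mem := fun k => ha k
      theta_mem := fun k => hθ k
      direction_ne_zero := fun k h0 => hξ k (by simpa using h0)
      split := fun k => by
        rw [Nat.cast_succ]
        exact hsplit k
      kernel := fun k i => by
        rw [Nat.cast_succ]
        exact congrFun (hker k) i
      norm_le := fun x hx => (hR₁ x hx).trans (le_max_left _ _)
      norm_center_le := fun k => (hR₂ _ ⟨_, rfl⟩).trans (le_max_right _ _) }
  refine hseq.not_isRigid ?_ (by simpa using hc) hne hbdd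
  obtain ⟨i₀, hi₀⟩ := Finite.exists_max θ
  refine squeeze_zero (fun k => Finset.prod_nonneg fun j _ => (hθ j).1.le) (fun k => ?_)
    (tendsto_pow_atTop_nhds_zero_of_lt_one (hθ i₀).1.le (hθ i₀).2)
  calc ∏ j ∈ Finset.range k, θ j ≤ ∏ _j ∈ Finset.range k, θ i₀ :=
        Finset.prod_le_prod (fun j _ => (hθ j).1.le) fun j _ => hi₀ j
    _ = θ i₀ ^ k := by simp

end Nonrigid

/-! ### The T₃ configuration -/

/-- `G⁻¹ D G` acts on the columns of `G⁻¹` as the diagonal matrix `D`. -/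
theorem conj_diagonal_mulVec_col {ι : Type*} [Fintype ι] [DecidableEq ι]
    (G : Matrix.GeneralLinearGroup ι ℝ) (d : ι → ℝ) (i : ι) :
    (((G⁻¹ : Matrix.GeneralLinearGroup ι ℝ) : Matrix ι ι ℝ) * Matrix.diagonal d *
        (G : Matrix ι ι ℝ)).mulVec
        (((G⁻¹ : Matrix.GeneralLinearGroup ι ℝ) : Matrix ι ι ℝ).mulVec (Pi.single i 1))
      = d i • ((G⁻¹ : Matrix.GeneralLinearGroup ι ℝ) : Matrix ι ι ℝ).mulVec (Pi.single i 1) := by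
  have hG : (G : Matrix ι ι ℝ) * ((G⁻¹ : Matrix.GeneralLinearGroup ι ℝ) : Matrix ι ι ℝ) = 1 :=
    Units.mul_inv G
  rw [Matrix.mulVec_mulVec, Matrix.mul_assoc, hG, Matrix.mul_one, ← Matrix.mulVec_mulVec,
    Matrix.diagonal_mulVec_single, mul_one, ← Matrix.mulVec_smul]
  congr 1
  rw [← Pi.single_smul, smul_eq_mul, mul_one]

theorem coe_mulVec_ne_zero {ι : Type*} [Fintype ι] [DecidableEq ι]
    (G : Matrix.GeneralLinearGroup ι ℝ) {w : ι → ℝ} (hw : w ≠ 0) :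
    (G : Matrix ι ι ℝ).mulVec w ≠ 0 := fun h => hw <| by
  have hG : ((G⁻¹ : Matrix.GeneralLinearGroup ι ℝ) : Matrix ι ι ℝ) * (G : Matrix ι ι ℝ) = 1 :=
    Units.inv_mul G
  rw [← Matrix.one_mulVec w, ← hG, ← Matrix.mulVec_mulVec, h, Matrix.mulVec_zero]

end DivFree

theorem theorem1p7 (q₁ q₂ q₃ : ℝ) (hq₁ : q₁ ∈ Set.Ioo (0 : ℝ) 1) (hq₂ : q₂ ∈ Set.Ioo (0 : ℝ) 1)
    (hq₃ : q₃ ∈ Set.Ioo (0 : ℝ) 1) (G : Matrix.GeneralLinearGroup (Fin 3) ℝ)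
    (M : Matrix (Fin 3) (Fin 3) ℝ) (N : Matrix.GeneralLinearGroup (Fin 3) ℝ)
    (Ω : TopologicalSpace.Opens (EuclideanSpace ℝ (Fin 3)))
    (hΩ_nonempty : (Ω : Set (EuclideanSpace ℝ (Fin 3))).Nonempty)
    (hΩ_bounded : Bornology.IsBounded (Ω : Set (EuclideanSpace ℝ (Fin 3)))) :
    ¬ DivFree.IsRigidForApproximateSolutions Ω
        ({M, (N : Matrix (Fin 3) (Fin 3) ℝ) + M,
          (N : Matrix (Fin 3) (Fin 3) ℝ) * DivFree.matrixA q₁ q₂ q₃ G + M} :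
          Set (Matrix (Fin 3) (Fin 3) ℝ)) := by
  obtain ⟨h1, h1'⟩ := hq₁
  obtain ⟨h2, h2'⟩ := hq₂
  obtain ⟨h3, h3'⟩ := hq₃
  have hs : 0 < q₁ + q₂ - q₁ * q₂ := by nlinarith
  have h1'' : 1 - q₁ ≠ 0 := by linarith
  set d : Fin 3 → ℝ := ![0, 1 / (1 - q₁), q₂ / (q₁ + q₂ - q₁ * q₂)] with hd
  set D : Matrix (Fin 3) (Fin 3) ℝ :=
    ((G⁻¹ : Matrix.GeneralLinearGroup (Fin 3) ℝ) : Matrix (Fin 3) (Fin 3) ℝ) *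
      Matrix.diagonal d * (G : Matrix (Fin 3) (Fin 3) ℝ) with hD
  set f : Fin 3 → Fin 3 → ℝ := fun i =>
    ((G⁻¹ : Matrix.GeneralLinearGroup (Fin 3) ℝ) : Matrix (Fin 3) (Fin 3) ℝ).mulVec
      (Pi.single i 1) with hf
  have hf0 : ∀ i, f i ≠ 0 := fun i => DivFree.coe_mulVec_ne_zero G⁻¹ (by simp)
  have hDf : ∀ i, D.mulVec (f i) = d i • f i := DivFree.conj_diagonal_mulVec_col G d
  -- Every matrix of the cycle is a combination of `D` and `1`, so the kernel conditions become
  -- scalar equations for eigenvalues on the `f i`.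
  have hcomb : ∀ (x y : ℝ) i, (x • D + y • (1 : Matrix (Fin 3) (Fin 3) ℝ)).mulVec (f i)
      = (x * d i + y) • f i := fun x y i => by
    rw [Matrix.add_mulVec, Matrix.smul_mulVec, Matrix.smul_mulVec, hDf, Matrix.one_mulVec]
    module
  set A := DivFree.matrixA q₁ q₂ q₃ G with hA
  set p := 1 - (1 - q₁) * (1 - q₂) * (1 - q₃) with hp
  have hA' : A = (p / q₃) • D + (-(q₂ * (1 - q₃) / q₃)) • (1 : Matrix (Fin 3) (Fin 3) ℝ) := by
    rw [hA, DivFree.matrixA, ← hd, ← hD, ← hp]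
    module
  let a : ZMod 3 → Matrix (Fin 3) (Fin 3) ℝ := ![A, 1, 0]
  let c : ZMod 3 → Matrix (Fin 3) (Fin 3) ℝ :=
    ![D, ((1 - q₂) * (1 - q₁)) • D + q₂ • (1 : Matrix (Fin 3) (Fin 3) ℝ), (1 - q₁) • D]
  let θ : ZMod 3 → ℝ := ![1 - q₃, 1 - q₂, 1 - q₁]
  let ξ : ZMod 3 → Fin 3 → ℝ := ![f 2, f 1, f 0]
  have forall_zmod : ∀ {P : ZMod 3 → Prop}, P 0 → P 1 → P 2 → ∀ i, P i := by
    intro P h0 h1 h2 i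
    fin_cases i
    exacts [h0, h1, h2]
  have hsplit : ∀ i, c i = (1 - θ i) • a i + θ i • c (i + 1) := by
    refine forall_zmod ?_ ?_ ?_
    · change D = (1 - (1 - q₃)) • A
        + (1 - q₃) • (((1 - q₂) * (1 - q₁)) • D + q₂ • (1 : Matrix (Fin 3) (Fin 3) ℝ))
      rw [hA', hp]
      match_scalars <;> field_simp <;> ring
    · change ((1 - q₂) * (1 - q₁)) • D + q₂ • (1 : Matrix (Fin 3) (Fin 3) ℝ)
        = (1 - (1 - q₂)) • (1 : Matrix (Fin 3) (Fin 3) ℝ) + (1 - q₂) • (1 - q₁) • D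
      module
    · change (1 - q₁) • D = (1 - (1 - q₁)) • (0 : Matrix (Fin 3) (Fin 3) ℝ) + (1 - q₁) • D
      module
  have hker : ∀ i, (c (i + 1) - a i).mulVec (ξ i) = 0 := by
    refine forall_zmod ?_ ?_ ?_
    · change (((1 - q₂) * (1 - q₁)) • D + q₂ • (1 : Matrix (Fin 3) (Fin 3) ℝ) - A).mulVec (f 2) = 0
      rw [Matrix.sub_mulVec, hA', hcomb, hcomb, ← sub_smul]
      convert zero_smul ℝ (f 2) using 2
      -- This is the equality of the eigenvalues of `c 1` and `A` on `f 2`, and it dictates the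
      -- third diagonal entry.
      have he : d 2 * (q₁ + q₂ - q₁ * q₂) = q₂ := div_mul_cancel₀ _ hs.ne'
      have hfac : (1 - q₂) * (1 - q₁) * d 2 + q₂ - (p / q₃ * d 2 + -(q₂ * (1 - q₃) / q₃))
          = (q₂ - d 2 * (q₁ + q₂ - q₁ * q₂)) / q₃ := by
        rw [hp]
        field_simp
        ring
      rw [hfac, he, sub_self, zero_div]
    · change ((1 - q₁) • D - 1).mulVec (f 1) = 0
      have : (1 - q₁) • D - 1 = (1 - q₁) • D + (-1 : ℝ) • (1 : Matrix (Fin 3) (Fin 3) ℝ) := by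
        module
      rw [this, hcomb]
      convert zero_smul ℝ (f 1) using 2
      simp only [hd, Matrix.cons_val]
      field_simp
      ring
    · change (D - 0).mulVec (f 0) = 0
      rw [sub_zero, hDf]
      simp [hd]
  -- `X ↦ N X + M` preserves convex combinations and acts on differences by left multiplication, so
  -- kernels survive.
  refine DivFree.not_isRigid_of_cycle (by simp)
    (a := fun i => (N : Matrix (Fin 3) (Fin 3) ℝ) * a i + M)
    (c := fun i => (N : Matrix (Fin 3) (Fin 3) ℝ) * c i + M) (θ := θ) (ξ := ξ)
    (forall_zmod ?_ ?_ ?_) (forall_zmod ?_ ?_ ?_) (forall_zmod ?_ ?_ ?_) (fun i => ?_)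
    (fun i => ?_) ?_ hΩ_nonempty hΩ_bounded
  · exact Or.inr (Or.inr rfl)
  · exact Or.inr (Or.inl (congrArg (· + M) (Matrix.mul_one _)))
  · exact Or.inl ((congrArg (· + M) (Matrix.mul_zero _)).trans (zero_add M))
  · exact ⟨sub_pos.2 h3', sub_lt_self _ h3⟩
  · exact ⟨sub_pos.2 h2', sub_lt_self _ h2⟩
  · exact ⟨sub_pos.2 h1', sub_lt_self _ h1⟩
  · exact hf0 2
  · exact hf0 1
  · exact hf0 0
  · rw [hsplit i, Matrix.mul_add, Matrix.mul_smul, Matrix.mul_smul]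
    module
  · rw [add_sub_add_right_eq_sub, ← Matrix.mul_sub, ← Matrix.mulVec_mulVec, hker,
      Matrix.mulVec_zero]
  · have hinj : ∀ X Y : Matrix (Fin 3) (Fin 3) ℝ,
        (N : Matrix (Fin 3) (Fin 3) ℝ) * X = (N : Matrix (Fin 3) (Fin 3) ℝ) * Y → X = Y :=
      fun X Y h => N.isUnit.mul_left_cancel h
    -- `D` has eigenvalue `1 / (1 - q₁) ≠ 0` on `f 1`, which excludes `0`. On `f 0` its eigenvalue
    -- is `0`, while those of `1` and `A` are nonzero.
    rintro (h | h | h)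
    · have h0 : D = 0 := hinj _ _ ((add_eq_right.1 h).trans (Matrix.mul_zero _).symm)
      have := hDf 1
      rw [h0, Matrix.zero_mulVec] at this
      exact smul_ne_zero (by simpa [hd] using h1'') (hf0 1) this.symm
    · have h0 : D = 1 := hinj _ _ ((add_right_cancel h).trans (Matrix.mul_one _).symm)
      have := hDf 0
      rw [h0, Matrix.one_mulVec] at this
      exact hf0 0 (this.trans (by simp [hd]))
    · have h0 : D = A := hinj _ _ (add_right_cancel h)
      have := hDf 0
      rw [h0, hA', hcomb] at this
      simp only [hd, Matrix.cons_val, mul_zero, zero_add, zero_smul] at this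
      have hne : -(q₂ * (1 - q₃) / q₃) ≠ 0 :=
        neg_ne_zero.2 (div_pos (mul_pos h2 (by linarith)) h3).ne'
      exact smul_ne_zero hne (hf0 0) this
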